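/- **Theorem (Equivalence).** Let $n\in\mathbb N$, $A_0,A_1\in\mathbb R^{n\times n}$ and $\tau\ge 0$, and suppose that the time-delay system $$\dot x(t)=A_0x(t)+A_1x(t-\tau),\qquad t\ge 0,$$ is exponentially stable, i.e. every solution $x$ (continuous on $[-\tau,\infty)$, with values in $\mathbb R^n$) satisfies $\|x(t)\|\le M e^{-\beta t}$ for all $t\ge 0$, for some constants $M>0$, $\beta>0$. Let $W\in\mathbb R^{n\times n}$ be symmetric. Then there is exactly one $U\in C^0([-\tau,\tau],\mathbb C^{n\times n})$ that solves the delay Lyapunov equation $$U'(t)=U(t)A_0+U(t-\tau)A_1\quad (0<t\le\tau),$$ $$U(-t)=U(t)^T\quad(-\tau\le t\le\tau),$$ $$-W=U(0)A_0+A_0^TU(0)+U(\tau)^TA_1+A_1^TU(\tau)$$ (the derivative at $t=\tau$ being one-sided). For $c\in\mathbb R$ define $L_c:\mathbb R^{n\times n}\to\mathbb R^{n\times n}$ by $$L_c(X):=Z_2(\tau/2)^T(A_0-cI)+(A_0^T+cI)Z_2(\tau/2)+Z_1(\tau/2)^TA_1+A_1^TZ_1(\tau/2),$$ where $Z_1,Z_2:[0,\tau/2]\to\mathbb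 R^{n\times n}$ are the unique solutions of the initial value problem $$Z_1'(t)=Z_1(t)A_0+Z_2(t)^TA_1,\qquad Z_2'(t)=-Z_1(t)^TA_1-Z_2(t)A_0,\qquad Z_1(0)=Z_2(0)=X.$$ Then for every real $c\ne 0$ the matrix $X=U(\tau/2)$ is real and is the unique solution in $\mathbb R^{n\times n}$ of the linear system $$L_c(X)=-W.$$ -/

import Mathlib

namespace DelayLyapunov

open Set

/-- `x` is a solution on `[-τ, ∞)` of the uncontrolled time-delay system
`x'(t) = A₀ x(t) + A₁ x(t - τ)`, `t ≥ 0` (right derivative at `t = 0`); its restriction to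
`[-τ, 0]` is an arbitrary continuous initial function. -/
structure IsTDSSolution {n : ℕ} (A₀ A₁ : Matrix (Fin n) (Fin n) ℝ) (τ : ℝ)
    (x : ℝ → EuclideanSpace ℝ (Fin n)) : Prop where
  continuousOn : ContinuousOn x (Ici (-τ))
  hasDeriv : ∀ t : ℝ, 0 ≤ t →
    HasDerivWithinAt x
      (WithLp.toLp 2 (A₀.mulVec (WithLp.ofLp (x t)) + A₁.mulVec (WithLp.ofLp (x (t - τ)))))
      (Ici 0) t

/-- Exponential stability: every solution of `x'(t) = A₀ x(t) + A₁ x(t - τ)` satisfies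
`‖x(t)‖ ≤ M exp(-β t)` for `t ≥ 0`, for some constants `M, β > 0`. -/
def ExponentiallyStable {n : ℕ} (A₀ A₁ : Matrix (Fin n) (Fin n) ℝ) (τ : ℝ) : Prop :=
  ∀ x : ℝ → EuclideanSpace ℝ (Fin n), IsTDSSolution A₀ A₁ τ x →
    ∃ M : ℝ, 0 < M ∧ ∃ β : ℝ, 0 < β ∧ ∀ t : ℝ, 0 ≤ t → ‖x t‖ ≤ M * Real.exp (-β * t)

/-- A real matrix regarded as a complex one. -/
def toComplex {n : ℕ} (A : Matrix (Fin n) (Fin n) ℝ) : Matrix (Fin n) (Fin n) ℂ :=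
  A.map (fun r : ℝ => (r : ℂ))

/-- `U ∈ C⁰([-τ, τ], ℂⁿˣⁿ)` solves the delay Lyapunov equation with cost matrix `W`.
Only the values of `U` on `[-τ, τ]` matter; at `t = τ` the derivative is the left one. -/
structure IsDelayLyapunovSolution {n : ℕ} (A₀ A₁ W : Matrix (Fin n) (Fin n) ℝ) (τ : ℝ)
    (U : ℝ → Matrix (Fin n) (Fin n) ℂ) : Prop where
  continuousOn : ContinuousOn U (Icc (-τ) τ)
  hasDeriv : ∀ t ∈ Ioc 0 τ,
    HasDerivWithinAt U (U t * toComplex A₀ + U (t - τ) * toComplex A₁) (Icc (-τ) τ) t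
  symm : ∀ t ∈ Icc (-τ) τ, U (-t) = (U t).transpose
  algebraic : -toComplex W =
    U 0 * toComplex A₀ + (toComplex A₀).transpose * U 0
      + (U τ).transpose * toComplex A₁ + (toComplex A₁).transpose * U τ

/-- `Z₁, Z₂` solve on `[0, T]` the coupled matrix initial value problem
`Z₁' = Z₁ A₀ + Z₂ᵀ A₁`, `Z₂' = -Z₁ᵀ A₁ - Z₂ A₀`, `Z₁(0) = Z₂(0) = X`
(one-sided derivatives at the end points). -/
structure IsCoupledSolution {n : ℕ} (A₀ A₁ : Matrix (Fin n) (Fin n) ℝ) (T : ℝ)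
    (X : Matrix (Fin n) (Fin n) ℝ) (Z₁ Z₂ : ℝ → Matrix (Fin n) (Fin n) ℝ) : Prop where
  init₁ : Z₁ 0 = X
  init₂ : Z₂ 0 = X
  hasDeriv₁ : ∀ t ∈ Icc 0 T,
    HasDerivWithinAt Z₁ (Z₁ t * A₀ + (Z₂ t).transpose * A₁) (Icc 0 T) t
  hasDeriv₂ : ∀ t ∈ Icc 0 T,
    HasDerivWithinAt Z₂ (-((Z₁ t).transpose * A₁) - Z₂ t * A₀) (Icc 0 T) t

theorem linearODE_exists {E : Type*} [NormedAddCommGroup E] [NormedSpace ℝ E] [CompleteSpace E]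
    (F : E →L[ℝ] E) (x : E) :
    ∃ z : ℝ → E, z 0 = x ∧ ∀ t, HasDerivAt z (F (z t)) t := by
  refine ⟨fun t => NormedSpace.exp (t • F) x, by simp, fun t => ?_⟩
  have h := (hasDerivAt_exp_smul_const' (𝕂 := ℝ) F t).clm_apply (hasDerivAt_const t x)
  simpa using h

theorem linearODE_unique {E : Type*} [NormedAddCommGroup E] [NormedSpace ℝ E]
    (F : E →L[ℝ] E) (T : ℝ) (z w : ℝ → E) (h0 : z 0 = w 0)
    (hz : ∀ t ∈ Icc 0 T, HasDerivWithinAt z (F (z t)) (Icc 0 T) t)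
    (hw : ∀ t ∈ Icc 0 T, HasDerivWithinAt w (F (w t)) (Icc 0 T) t) :
    EqOn z w (Icc 0 T) := by
  have key : ∀ y : ℝ → E, (∀ t ∈ Icc 0 T, HasDerivWithinAt y (F (y t)) (Icc 0 T) t) →
      ∀ t ∈ Ico 0 T, HasDerivWithinAt y (F (y t)) (Ici t) t := by
    intro y hy t ht
    have h1 := (hy t ⟨ht.1, ht.2.le⟩).mono (Icc_subset_Icc_left ht.1)
    exact h1.mono_of_mem_nhdsWithin (Icc_mem_nhdsGE ht.2)
  exact ODE_solution_unique (v := fun _ => F) (fun _ => F.lipschitz)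
    (fun t ht => (hz t ht).continuousWithinAt) (key z hz)
    (fun t ht => (hw t ht).continuousWithinAt) (key w hw) h0

/-- The right-hand side of the coupled system, as a linear map on pairs of matrices. -/
def coupledRHS {n : ℕ} (A₀ A₁ : Matrix (Fin n) (Fin n) ℝ) :
    (Matrix (Fin n) (Fin n) ℝ × Matrix (Fin n) (Fin n) ℝ) →ₗ[ℝ]
      (Matrix (Fin n) (Fin n) ℝ × Matrix (Fin n) (Fin n) ℝ) where
  toFun Z := (Z.1 * A₀ + Z.2.transpose * A₁, -(Z.1.transpose * A₁) - Z.2 * A₀)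
  map_add' Z Y := by
    ext1 <;> simp only [Prod.fst_add, Prod.snd_add, Matrix.transpose_add, add_mul] <;> abel
  map_smul' r Z := by
    ext1 <;> simp [smul_add, smul_sub]

section

attribute [local instance] Matrix.normedAddCommGroup Matrix.normedSpace

theorem exists_isCoupledSolution {n : ℕ} (A₀ A₁ : Matrix (Fin n) (Fin n) ℝ) (T : ℝ)
    (X : Matrix (Fin n) (Fin n) ℝ) :
    ∃ Z : (ℝ → Matrix (Fin n) (Fin n) ℝ) × (ℝ → Matrix (Fin n) (Fin n) ℝ),
      IsCoupledSolution A₀ A₁ T X Z.1 Z.2 := by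
  obtain ⟨z, h0, hz⟩ := linearODE_exists (LinearMap.toContinuousLinearMap (coupledRHS A₀ A₁)) (X, X)
  refine ⟨(fun t => (z t).1, fun t => (z t).2), ⟨by simp [h0], by simp [h0], ?_, ?_⟩⟩
  · intro t _
    exact ((ContinuousLinearMap.fst ℝ _ _).hasFDerivAt.comp_hasDerivAt t (hz t)).hasDerivWithinAt
  · intro t _
    exact ((ContinuousLinearMap.snd ℝ _ _).hasFDerivAt.comp_hasDerivAt t (hz t)).hasDerivWithinAt

theorem IsCoupledSolution.unique {n : ℕ} {A₀ A₁ : Matrix (Fin n) (Fin n) ℝ} {T : ℝ}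
    {X : Matrix (Fin n) (Fin n) ℝ} {Z₁ Z₂ Y₁ Y₂ : ℝ → Matrix (Fin n) (Fin n) ℝ}
    (hZ : IsCoupledSolution A₀ A₁ T X Z₁ Z₂) (hY : IsCoupledSolution A₀ A₁ T X Y₁ Y₂) :
    EqOn Z₁ Y₁ (Icc 0 T) ∧ EqOn Z₂ Y₂ (Icc 0 T) := by
  have h := linearODE_unique (LinearMap.toContinuousLinearMap (coupledRHS A₀ A₁)) T
    (fun t => (Z₁ t, Z₂ t)) (fun t => (Y₁ t, Y₂ t))
    (by simp [hZ.init₁, hZ.init₂, hY.init₁, hY.init₂])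
    (fun t ht => (hZ.hasDeriv₁ t ht).prodMk (hZ.hasDeriv₂ t ht))
    (fun t ht => (hY.hasDeriv₁ t ht).prodMk (hY.hasDeriv₂ t ht))
  exact ⟨fun t ht => congrArg Prod.fst (h ht), fun t ht => congrArg Prod.snd (h ht)⟩

end

/-- The expression `Z₂ᵀ (A₀ - c I) + (A₀ᵀ + c I) Z₂ + Z₁ᵀ A₁ + A₁ᵀ Z₁`. -/
def boundaryExpr {n : ℕ} (A₀ A₁ : Matrix (Fin n) (Fin n) ℝ) (c : ℝ)
    (Z₁ Z₂ : Matrix (Fin n) (Fin n) ℝ) : Matrix (Fin n) (Fin n) ℝ :=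
  Z₂.transpose * (A₀ - c • (1 : Matrix (Fin n) (Fin n) ℝ))
    + (A₀.transpose + c • (1 : Matrix (Fin n) (Fin n) ℝ)) * Z₂
    + Z₁.transpose * A₁ + A₁.transpose * Z₁

/-- The operator `L_c : ℝⁿˣⁿ → ℝⁿˣⁿ`: the boundary expression evaluated at `Z₁(τ/2)`, `Z₂(τ/2)`,
where `Z₁, Z₂` is the unique solution on `[0, τ/2]` of the coupled initial value problem with
`Z₁(0) = Z₂(0) = X`. -/
noncomputable def Lop {n : ℕ} (A₀ A₁ : Matrix (Fin n) (Fin n) ℝ) (τ c : ℝ)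
    (X : Matrix (Fin n) (Fin n) ℝ) : Matrix (Fin n) (Fin n) ℝ :=
  boundaryExpr A₀ A₁ c
    ((exists_isCoupledSolution A₀ A₁ (τ / 2) X).choose.1 (τ / 2))
    ((exists_isCoupledSolution A₀ A₁ (τ / 2) X).choose.2 (τ / 2))

/-- `L_c` may be computed from any solution of the coupled initial value problem. -/
theorem Lop_eq {n : ℕ} {A₀ A₁ : Matrix (Fin n) (Fin n) ℝ} {τ : ℝ} (hτ : 0 ≤ τ) (c : ℝ)
    {X : Matrix (Fin n) (Fin n) ℝ} {Z₁ Z₂ : ℝ → Matrix (Fin n) (Fin n) ℝ}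
    (hZ : IsCoupledSolution A₀ A₁ (τ / 2) X Z₁ Z₂) :
    Lop A₀ A₁ τ c X = boundaryExpr A₀ A₁ c (Z₁ (τ / 2)) (Z₂ (τ / 2)) := by
  have h := (exists_isCoupledSolution A₀ A₁ (τ / 2) X).choose_spec.unique hZ
  have hmem : τ / 2 ∈ Icc (0 : ℝ) (τ / 2) := ⟨by linarith, le_refl _⟩
  rw [Lop, h.1 hmem, h.2 hmem]

end DelayLyapunov

/-!
Let `G` solve the reflection equation `G'(t) = G(t) A₀ + G(-t)ᵀ A₁` with `G(0) = X`. Then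
`Z₁(t) = G(t)`, `Z₂(t) = G(-t)` is the coupled solution with initial value `X`, and a real solution
`U` of the delay Lyapunov equation is `G(t - τ/2)` on `[0, τ]` with `X = U(τ/2)`. If the right-hand
side `-W` is symmetric and `c ≠ 0`, comparing `L_c(X)` with its transpose forces
`Z₂(τ/2) = G(-τ/2)` to be symmetric, so solutions of `L_c(X) = -W` correspond exactly to real
solutions `U`. As `L_c` is a linear endomorphism of a finite-dimensional space, everything reduces
to its injectivity, `eq_zero_of_Lop_eq_zero`; complex solutions are treated through their real and
imaginary parts.

Injectivity is a statement about `W = 0`. In that case `U` is continuously differentiable across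
`0`, and satisfies `U'(r) = U(r) A₀ + U(r - τ) A₁` on `[0, τ]` and
`U'(r) = -A₀ᵀ U(r) - A₁ᵀ U(r + τ)` on `[-τ, 0]`. For a solution `y` of the time-delay system put
`q(t) = U(0) y(t) + ∫_{t-τ}^t U(t - τ - s) A₁ y(s) ds` (`costate`). The first form of the equation
shows that `q(r)` can be computed from the segment of `y` ending at any `t ∈ [r - τ, r]`
(`costate_eq`); differentiating at fixed `t` and using the second form gives the adjoint equation
`q'(t) = -A₀ᵀ q(t) - A₁ᵀ q(t + τ)` (`hasDerivWithinAt_costate`). Hence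
`x(t) ⬝ q(t) + ∫_{t-τ}^t A₁ x(s) ⬝ q(s + τ) ds` is constant along every solution `x`, and since
`x` and `q` tend to zero by stability, it vanishes (`pairing_eq_zero`). The initial functions of `x`
and `y` are arbitrary (`exists_delay_solution`), so first `q(0) = 0` for every `y`, then `U(0) = 0`
and `U A₁ = 0` on `[-τ, 0]`. What remains of the equation is `U' = U A₀`, so `U = 0`
(`eq_zero_of_homogeneous`).
-/

namespace DelayLyapunov

open Set Filter Topology Matrix

/-! ### Calculus of moving integrals and matrix products -/

section Calculus

/-- Two differentiable functions whose values and derivatives agree at `0` glue to a differentiable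
function. -/
theorem hasDerivAt_ite_nonneg {E : Type*} [NormedAddCommGroup E] [NormedSpace ℝ E]
    {f g f' g' : ℝ → E} (hf : ∀ t, HasDerivAt f (f' t) t) (hg : ∀ t, HasDerivAt g (g' t) t)
    (h : f 0 = g 0) (h' : f' 0 = g' 0) (t : ℝ) :
    HasDerivAt (fun s => if 0 ≤ s then f s else g s) (if 0 ≤ t then f' t else g' t) t := by
  rcases lt_trichotomy t 0 with ht | rfl | ht
  · rw [if_neg ht.not_ge]
    refine (hg t).congr_of_eventuallyEq ?_
    filter_upwards [Iio_mem_nhds ht] with s hs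
    rw [if_neg (not_le.2 hs)]
  · rw [if_pos le_rfl, ← hasDerivWithinAt_univ, ← Ici_union_Iic (a := (0 : ℝ))]
    refine HasDerivWithinAt.union ?_ ?_
    · exact (hf 0).hasDerivWithinAt.congr (fun s hs => if_pos hs) (if_pos le_rfl)
    · rw [h']
      have key : ∀ s ∈ Iic (0 : ℝ), (if 0 ≤ s then f s else g s) = g s := by
        intro s hs
        split_ifs with h0
        · rw [le_antisymm hs h0, h]
        · rfl
      exact (hg 0).hasDerivWithinAt.congr key (key 0 self_mem_Iic)
  · rw [if_pos ht.le]
    refine (hf t).congr_of_eventuallyEq ?_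
    filter_upwards [Ioi_mem_nhds ht] with s hs
    rw [if_pos (le_of_lt hs)]

theorem hasDerivAt_integral_window {E : Type*} [NormedAddCommGroup E] [NormedSpace ℝ E]
    [CompleteSpace E] {f : ℝ → E} (hf : Continuous f) (τ t : ℝ) :
    HasDerivAt (fun r => ∫ s in (r - τ)..r, f s) (f t - f (t - τ)) t := by
  have key : (fun r => ∫ s in (r - τ)..r, f s)
      = fun r => (∫ s in (0 : ℝ)..r, f s) - ∫ s in (0 : ℝ)..(r - τ), f s := by
    funext r
    rw [intervalIntegral.integral_interval_sub_left] <;> exact hf.intervalIntegrable _ _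
  rw [key]
  have h := hf.integral_hasStrictDerivAt 0
  refine (h t).hasDerivAt.sub ?_
  simpa using (h (t - τ)).hasDerivAt.comp_sub_const t τ

theorem tendsto_integral_window {E : Type*} [NormedAddCommGroup E] [NormedSpace ℝ E]
    {τ : ℝ} (hτ : 0 ≤ τ) {k : ℝ → ℝ → E} {g : ℝ → ℝ} (hg : Tendsto g atTop (𝓝 0))
    (hk : ∀ t, ∀ s ∈ Icc (t - τ) t, ‖k t s‖ ≤ g s) :
    Tendsto (fun t => ∫ s in (t - τ)..t, k t s) atTop (𝓝 0) := by
  rw [Metric.tendsto_atTop]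
  intro ε hε
  have hd : 0 < ε / (τ + 1) := by positivity
  obtain ⟨N, hN⟩ := (Metric.tendsto_atTop.1 hg) _ hd
  refine ⟨N + τ, fun t ht => ?_⟩
  rw [dist_zero_right]
  have h1 : ‖∫ s in (t - τ)..t, k t s‖ ≤ ε / (τ + 1) * |t - (t - τ)| := by
    refine intervalIntegral.norm_integral_le_of_norm_le_const fun s hs => ?_
    rw [uIoc_of_le (by linarith)] at hs
    have h2 := hN s (by linarith [hs.1])
    rw [Real.dist_eq, sub_zero] at h2
    exact (hk t s ⟨hs.1.le, hs.2⟩).trans ((le_abs_self _).trans h2.le)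
  refine h1.trans_lt ?_
  rw [sub_sub_cancel, abs_of_nonneg hτ, div_mul_eq_mul_div, div_lt_iff₀ (by linarith)]
  nlinarith

/-- Differentiation under the integral sign for a jointly continuous derivative. -/
theorem hasDerivAt_integral_of_continuous {E : Type*} [NormedAddCommGroup E] [NormedSpace ℝ E]
    {F F' : ℝ → ℝ → E} (hF : ∀ r, Continuous (F r)) (hF' : Continuous F'.uncurry)
    (h : ∀ r s, HasDerivAt (fun r => F r s) (F' r s) r) (a b r₀ : ℝ) :
    HasDerivAt (fun r => ∫ s in a..b, F r s) (∫ s in a..b, F' r₀ s) r₀ := by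
  obtain ⟨C, hC⟩ := ((isCompact_closedBall r₀ 1).prod (isCompact_uIcc (a := a) (b := b))
    ).exists_bound_of_continuousOn hF'.continuousOn
  refine (intervalIntegral.hasDerivAt_integral_of_dominated_loc_of_deriv_le
    (bound := fun _ => C) (Metric.closedBall_mem_nhds r₀ one_pos)
    (Eventually.of_forall fun r => (hF r).aestronglyMeasurable)
    ((hF r₀).intervalIntegrable _ _)
    (hF'.comp (Continuous.prodMk_right r₀)).aestronglyMeasurable ?_ (by simp) ?_).2
  · exact Eventually.of_forall fun s hs r hr => hC (r, s) ⟨hr, uIoc_subset_uIcc hs⟩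
  · exact Eventually.of_forall fun s _ r _ => h r s

variable {m : Type*} [Fintype m]

theorem hasDerivWithinAt_mulVec {A : ℝ → Matrix m m ℝ} {A' : Matrix m m ℝ} {v : ℝ → m → ℝ}
    {v' : m → ℝ} {s : Set ℝ} {t : ℝ}
    (hA : ∀ i j, HasDerivWithinAt (fun r => A r i j) (A' i j) s t)
    (hv : HasDerivWithinAt v v' s t) :
    HasDerivWithinAt (fun r => A r *ᵥ v r) (A' *ᵥ v t + A t *ᵥ v') s t := by
  rw [hasDerivWithinAt_pi]
  intro i
  have h := HasDerivWithinAt.fun_sum (u := Finset.univ)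
    fun j _ => (hA i j).fun_mul (hasDerivWithinAt_pi.1 hv j)
  simpa only [mulVec, dotProduct, Pi.add_apply, ← Finset.sum_add_distrib] using h

theorem hasDerivWithinAt_dotProduct {v w : ℝ → m → ℝ} {v' w' : m → ℝ} {s : Set ℝ} {t : ℝ}
    (hv : HasDerivWithinAt v v' s t) (hw : HasDerivWithinAt w w' s t) :
    HasDerivWithinAt (fun r => v r ⬝ᵥ w r) (v' ⬝ᵥ w t + v t ⬝ᵥ w') s t := by
  have h := HasDerivWithinAt.fun_sum (u := Finset.univ)
    fun j _ => (hasDerivWithinAt_pi.1 hv j).fun_mul (hasDerivWithinAt_pi.1 hw j)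
  simpa only [dotProduct, ← Finset.sum_add_distrib] using h

theorem mulVec_integral (B : Matrix m m ℝ) {f : ℝ → m → ℝ} (hf : Continuous f) (a b : ℝ) :
    B *ᵥ (∫ s in a..b, f s) = ∫ s in a..b, B *ᵥ f s :=
  ((LinearMap.toContinuousLinearMap B.mulVecLin).intervalIntegral_comp_comm
    (hf.intervalIntegrable a b)).symm

/-- A functional made of a point mass at the right end point and a continuous density vanishes on
all continuous functions only if both parts vanish. -/
theorem eq_zero_of_forall_dotProduct_add_integral {τ : ℝ} (hτ : 0 ≤ τ) {a : m → ℝ}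
    {b : ℝ → m → ℝ} (hb : Continuous b)
    (h : ∀ φ : ℝ → m → ℝ, Continuous φ → a ⬝ᵥ φ 0 + ∫ s in (-τ)..0, b s ⬝ᵥ φ s = 0) :
    a = 0 ∧ (0 < τ → ∀ s ∈ Icc (-τ) 0, b s = 0) := by
  have hb0 : 0 < τ → ∀ s ∈ Icc (-τ) 0, b s = 0 := by
    intro hτ'
    -- the factor `s ^ 2` removes the contribution of the point mass
    have h1 := h (fun s => (s ^ 2) • b s) (by fun_prop)
    have h2 : ∫ s in (-τ)..0, b s ⬝ᵥ ((s ^ 2) • b s) = 0 := by simpa using h1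
    have hc : Continuous fun s => b s ⬝ᵥ ((s ^ 2) • b s) :=
      Continuous.dotProduct hb (by fun_prop)
    have hnn : ∀ s, 0 ≤ b s ⬝ᵥ ((s ^ 2) • b s) := fun s => by
      rw [dotProduct_smul]
      exact mul_nonneg (sq_nonneg s) (Finset.sum_nonneg fun i _ => mul_self_nonneg _)
    have hz : ∀ s ∈ Ico (-τ) 0, b s = 0 := by
      intro s hs
      by_contra hne
      have hpos : 0 < b s ⬝ᵥ ((s ^ 2) • b s) := by
        refine (hnn s).lt_of_ne' fun h0 => hne ?_
        rw [dotProduct_smul, smul_eq_mul, mul_eq_zero] at h0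
        exact dotProduct_self_eq_zero.1 (h0.resolve_left (pow_ne_zero 2 hs.2.ne))
      have := intervalIntegral.integral_pos (a := -τ) (b := 0) (by linarith) hc.continuousOn
        (fun x _ => hnn x) ⟨s, ⟨hs.1, hs.2.le⟩, hpos⟩
      exact this.ne' h2
    have hcl : IsClosed {s | b s = 0} := isClosed_eq hb continuous_const
    have := hcl.closure_subset_iff.2 (show Ico (-τ) 0 ⊆ {s | b s = 0} from hz)
    rw [closure_Ico (by linarith)] at this
    exact this
  refine ⟨?_, hb0⟩
  have h1 := h (fun _ => a) continuous_const
  have h2 : ∫ s in (-τ)..0, b s ⬝ᵥ a = 0 := by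
    rcases hτ.eq_or_lt with rfl | hτ'
    · simp
    · rw [intervalIntegral.integral_congr (g := fun _ => (0 : ℝ)), intervalIntegral.integral_zero]
      intro s hs
      rw [uIcc_of_le (by linarith)] at hs
      simp [hb0 hτ' s hs]
  rw [h2, add_zero] at h1
  exact dotProduct_self_eq_zero.1 h1

end Calculus

/-! ### Solutions with a prescribed initial function -/

section Existence

variable {E : Type*} [NormedAddCommGroup E] [NormedSpace ℝ E]

/-- The variation-of-constants map of `x'(t) = F₀ x(t) + F₁ x(t - τ)` with initial function `φ`;
its fixed points are the solutions with that initial function. -/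
noncomputable def variationMap (F₀ F₁ : E →L[ℝ] E) (τ : ℝ) (φ x : ℝ → E) (t : ℝ) : E :=
  if t ≤ 0 then φ t else
    NormedSpace.exp (t • F₀)
      (φ 0 + ∫ s in (0 : ℝ)..t, NormedSpace.exp ((-s) • F₀) (F₁ (x (s - τ))))

theorem variationMap_congr {F₀ F₁ : E →L[ℝ] E} {τ : ℝ} {φ x y : ℝ → E} {T : ℝ}
    (h : ∀ s ≤ T - τ, x s = y s) :
    ∀ t ≤ T, variationMap F₀ F₁ τ φ x t = variationMap F₀ F₁ τ φ y t := by
  intro t ht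
  unfold variationMap
  split_ifs with h0
  · rfl
  · congr 2
    refine intervalIntegral.integral_congr fun s hs => ?_
    rw [uIcc_of_le (not_le.1 h0).le] at hs
    rw [h (s - τ) (by linarith [hs.2])]

variable [CompleteSpace E] {F₀ F₁ : E →L[ℝ] E} {τ : ℝ} {φ : ℝ → E}

theorem continuous_exp_smul (F : E →L[ℝ] E) : Continuous fun t : ℝ => NormedSpace.exp (t • F) :=
  continuous_iff_continuousAt.2 fun t => (hasDerivAt_exp_smul_const (𝕂 := ℝ) F t).continuousAt

theorem continuous_variationMap (hφ : Continuous φ) {x : ℝ → E} (hx : Continuous x) :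
    Continuous (variationMap F₀ F₁ τ φ x) := by
  have hexp := continuous_exp_smul F₀
  have hint : Continuous fun s => NormedSpace.exp ((-s) • F₀) (F₁ (x (s - τ))) :=
    (hexp.comp continuous_neg).clm_apply (by fun_prop)
  refine Continuous.if_le hφ ?_ continuous_id continuous_const ?_
  · exact hexp.clm_apply (continuous_const.add
      (intervalIntegral.continuous_primitive (fun a b => hint.intervalIntegrable a b) 0))
  · rintro t rfl
    simp

theorem hasDerivWithinAt_of_eq_variationMap {x : ℝ → E} (hx : Continuous x)
    (hfix : variationMap F₀ F₁ τ φ x = x) {t : ℝ} (ht : 0 ≤ t) :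
    HasDerivWithinAt x (F₀ (x t) + F₁ (x (t - τ))) (Ici 0) t := by
  have hint : Continuous fun s => NormedSpace.exp ((-s) • F₀) (F₁ (x (s - τ))) :=
    ((continuous_exp_smul F₀).comp continuous_neg).clm_apply (by fun_prop)
  set z : ℝ → E := fun t => NormedSpace.exp (t • F₀)
      (φ 0 + ∫ s in (0 : ℝ)..t, NormedSpace.exp ((-s) • F₀) (F₁ (x (s - τ)))) with hz
  have hxz : ∀ t ∈ Ici (0 : ℝ), x t = z t := by
    intro t ht
    rw [← hfix]
    unfold variationMap
    split_ifs with h0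
    · rw [le_antisymm h0 ht]
      simp [hz]
    · rfl
  have h1 := (hasDerivAt_exp_smul_const' (𝕂 := ℝ) F₀ t).clm_apply
    (((hint.integral_hasStrictDerivAt 0 t).hasDerivAt).const_add (φ 0))
  have hinv : NormedSpace.exp (t • F₀) (NormedSpace.exp ((-t) • F₀) (F₁ (x (t - τ))))
      = F₁ (x (t - τ)) := by
    let _ : NormedAlgebra ℚ (E →L[ℝ] E) := NormedAlgebra.restrictScalars ℚ ℝ _
    rw [← mul_apply_eq_comp, ← NormedSpace.exp_add_of_commute]
    · simp
    · exact ((Commute.refl F₀).smul_left t).smul_right (-t)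
  refine HasDerivWithinAt.congr (f := z) ?_ hxz (hxz t ht)
  rw [hxz t ht]
  refine (h1.congr_deriv ?_).hasDerivWithinAt
  rw [hinv]
  rfl

/-- Every continuous initial function extends to a solution of the delay equation. For `τ > 0` the
iterates of the variation-of-constants map stabilise on each half-line `(-∞, k τ]`. -/
theorem exists_delay_solution (F₀ F₁ : E →L[ℝ] E) (hτ : 0 ≤ τ) (hφ : Continuous φ) :
    ∃ x : ℝ → E, Continuous x ∧ (∀ t ≤ 0, x t = φ t) ∧
      ∀ t, 0 ≤ t → HasDerivWithinAt x (F₀ (x t) + F₁ (x (t - τ))) (Ici 0) t := by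
  rcases hτ.eq_or_lt with rfl | hτ'
  · obtain ⟨z, hz0, hz⟩ := linearODE_exists (F₀ + F₁) (φ 0)
    have hzc : Continuous z := continuous_iff_continuousAt.2 fun t => (hz t).continuousAt
    have hpos : ∀ t ∈ Ici (0 : ℝ), (if t ≤ 0 then φ t else z t) = z t := by
      intro t ht
      split_ifs with h
      · rw [le_antisymm h ht, hz0]
      · rfl
    refine ⟨fun t => if t ≤ 0 then φ t else z t,
      Continuous.if_le hφ hzc continuous_id continuous_const (by rintro t rfl; exact hz0.symm),
      fun t ht => if_pos ht, fun t ht => ?_⟩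
    simp only [sub_zero, hpos t ht]
    exact ((hz t).hasDerivWithinAt).congr hpos (hpos t ht)
  · set Φ := variationMap F₀ F₁ τ φ with hΦ
    set X : ℕ → ℝ → E := fun k => Φ^[k] φ with hX
    have hsucc : ∀ k, X (k + 1) = Φ (X k) := fun k => Function.iterate_succ_apply' Φ k φ
    have hXc : ∀ k, Continuous (X k) := by
      intro k
      induction k with
      | zero => exact hφ
      | succ k ih => rw [hsucc]; exact continuous_variationMap hφ ih
    have hstep : ∀ k : ℕ, ∀ t ≤ k * τ, X (k + 1) t = X k t := by
      intro k
      induction k with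
      | zero =>
        intro t ht
        rw [hsucc]
        exact if_pos (by simpa using ht)
      | succ k ih =>
        intro t ht
        rw [hsucc (k + 1)]
        conv_rhs => rw [hsucc k]
        refine variationMap_congr (T := (k + 1 : ℕ) * τ) (fun s hs => ih s ?_) t ht
        push_cast at hs
        linarith
    have hstab : ∀ k l : ℕ, k ≤ l → ∀ t ≤ k * τ, X l t = X k t := by
      intro k l hkl
      induction l, hkl using Nat.le_induction with
      | base => intro t _; rfl
      | succ l hl ih =>
        intro t ht
        rw [hstep l t (ht.trans (by gcongr)), ih t ht]
    obtain ⟨x, hx⟩ : ∃ x : ℝ → E, ∀ k : ℕ, ∀ t ≤ k * τ, x t = X k t := by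
      refine ⟨fun t => X ⌈t / τ⌉₊ t, fun k t ht => ?_⟩
      have h1 : ⌈t / τ⌉₊ ≤ k := Nat.ceil_le.2 ((div_le_iff₀ hτ').2 ht)
      exact (hstab _ _ h1 t ((div_le_iff₀ hτ').1 (Nat.le_ceil _))).symm
    have hex : ∀ t : ℝ, ∃ k : ℕ, t < k * τ := fun t => by
      obtain ⟨k, hk⟩ := exists_nat_gt (t / τ)
      exact ⟨k, (div_lt_iff₀ hτ').1 hk⟩
    have hxc : Continuous x := by
      refine continuous_iff_continuousAt.2 fun t => ?_
      obtain ⟨k, hk⟩ := hex t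
      refine (hXc k).continuousAt.congr ?_
      filter_upwards [Iio_mem_nhds hk] with s hs
      exact (hx k s (le_of_lt hs)).symm
    have hfix : Φ x = x := by
      funext t
      obtain ⟨k, hk⟩ := hex t
      rw [hx (k + 1) t (hk.le.trans (by push_cast; linarith)), hsucc]
      refine variationMap_congr (T := k * τ) (fun s hs => hx k s (by linarith)) t hk.le
    refine ⟨x, hxc, fun t ht => ?_, fun t ht => hasDerivWithinAt_of_eq_variationMap hxc hfix ht⟩
    rw [hx 0 t (by simpa using ht)]
    rfl

end Existence

/-! ### Vanishing of smooth solutions of the homogeneous equation -/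

section Homogeneous

variable {n : ℕ} {A₀ A₁ : Matrix (Fin n) (Fin n) ℝ} {τ : ℝ}

theorem exists_tendsto_zero_solution (hτ : 0 ≤ τ) (hstab : ExponentiallyStable A₀ A₁ τ)
    {φ : ℝ → Fin n → ℝ} (hφ : Continuous φ) :
    ∃ x : ℝ → Fin n → ℝ, Continuous x ∧ (∀ t ≤ 0, x t = φ t) ∧
      (∀ t, 0 ≤ t → HasDerivWithinAt x (A₀ *ᵥ x t + A₁ *ᵥ x (t - τ)) (Ici t) t) ∧
      Tendsto x atTop (𝓝 0) := by
  obtain ⟨x, hxc, hx0, hx⟩ := exists_delay_solution (LinearMap.toContinuousLinearMap A₀.mulVecLin)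
    (LinearMap.toContinuousLinearMap A₁.mulVecLin) hτ hφ
  refine ⟨x, hxc, hx0, fun t ht => (hx t ht).mono (Ici_subset_Ici.2 ht), ?_⟩
  let e := (PiLp.continuousLinearEquiv 2 ℝ (fun _ : Fin n => ℝ)).symm
  have hsol : IsTDSSolution A₀ A₁ τ fun t => e (x t) := by
    refine ⟨(e.continuous.comp hxc).continuousOn, fun t ht => ?_⟩
    exact e.toContinuousLinearMap.hasFDerivAt.comp_hasDerivWithinAt t (hx t ht)
  obtain ⟨M, -, β, hβ, hM⟩ := hstab _ hsol
  have h1 : Tendsto (fun t => e (x t)) atTop (𝓝 0) := by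
    refine squeeze_zero_norm' (a := fun t => M * Real.exp (-β * t)) ?_ ?_
    · filter_upwards [eventually_ge_atTop 0] with t ht using hM t ht
    · have h2 : Tendsto (fun t : ℝ => -β * t) atTop atBot :=
        tendsto_id.const_mul_atTop_of_neg (by linarith)
      simpa using (Real.tendsto_exp_atBot.comp h2).const_mul M
  have h3 := (e.symm.continuous.tendsto 0).comp h1
  simpa [Function.comp_def] using h3

/-- A solution of the delay equation and a solution of the adjoint (advanced) equation have a
conserved pairing; when both tend to zero the pairing vanishes. -/
theorem pairing_eq_zero (hτ : 0 ≤ τ) {x q : ℝ → Fin n → ℝ} (hxc : Continuous x)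
    (hqc : Continuous q)
    (hx : ∀ t, 0 ≤ t → HasDerivWithinAt x (A₀ *ᵥ x t + A₁ *ᵥ x (t - τ)) (Ici t) t)
    (hq : ∀ t, 0 ≤ t → HasDerivWithinAt q (-(A₀ᵀ *ᵥ q t) - A₁ᵀ *ᵥ q (t + τ)) (Ici t) t)
    (hx0 : Tendsto x atTop (𝓝 0)) (hq0 : Tendsto q atTop (𝓝 0)) :
    x 0 ⬝ᵥ q 0 + ∫ s in (-τ)..0, (A₁ *ᵥ x s) ⬝ᵥ q (s + τ) = 0 := by
  have hk : Continuous fun s => (A₁ *ᵥ x s) ⬝ᵥ q (s + τ) :=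
    Continuous.dotProduct (continuous_const.matrix_mulVec hxc) (by fun_prop)
  set P : ℝ → ℝ := fun t => x t ⬝ᵥ q t + ∫ s in (t - τ)..t, (A₁ *ᵥ x s) ⬝ᵥ q (s + τ) with hP
  have hPd : ∀ t, 0 ≤ t → HasDerivWithinAt P 0 (Ici t) t := by
    intro t ht
    refine ((hasDerivWithinAt_dotProduct (hx t ht) (hq t ht)).add
      (hasDerivAt_integral_window hk τ t).hasDerivWithinAt).congr_deriv ?_
    have hadj : ∀ (B : Matrix (Fin n) (Fin n) ℝ) (v w : Fin n → ℝ),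
        v ⬝ᵥ Bᵀ *ᵥ w = (B *ᵥ v) ⬝ᵥ w := fun B v w => by
      rw [dotProduct_mulVec, vecMul_transpose]
    simp only [add_dotProduct, dotProduct_sub, dotProduct_neg, hadj, sub_add_cancel]
    ring
  have hPc : Continuous P := by
    refine (Continuous.dotProduct hxc hqc).add ?_
    exact continuous_iff_continuousAt.2 fun t => (hasDerivAt_integral_window hk τ t).continuousAt
  have hconst : ∀ t, 0 ≤ t → P t = P 0 := fun t ht =>
    constant_of_has_deriv_right_zero hPc.continuousOn (fun s hs => hPd s hs.1) t ⟨ht, le_rfl⟩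
  have hlim : Tendsto P atTop (𝓝 0) := by
    have hq1 : Tendsto (fun s => q (s + τ)) atTop (𝓝 0) :=
      hq0.comp (tendsto_atTop_add_const_right _ _ tendsto_id)
    have hx1 : Tendsto (fun s => A₁ *ᵥ x s) atTop (𝓝 0) := by
      have := ((continuous_const (y := A₁)).matrix_mulVec
        (continuous_id (X := Fin n → ℝ))).tendsto 0
      simpa [Function.comp_def] using this.comp hx0
    have hdot : ∀ {v w : ℝ → Fin n → ℝ}, Tendsto v atTop (𝓝 0) → Tendsto w atTop (𝓝 0) →
        Tendsto (fun t => v t ⬝ᵥ w t) atTop (𝓝 0) := by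
      intro v w hv hw
      have hd : Continuous fun p : (Fin n → ℝ) × (Fin n → ℝ) => p.1 ⬝ᵥ p.2 :=
        Continuous.dotProduct continuous_fst continuous_snd
      have := hd.tendsto (0, 0)
      rw [nhds_prod_eq] at this
      simpa [Function.comp_def] using this.comp (hv.prodMk hw)
    have h2 := tendsto_integral_window hτ (k := fun _ s => (A₁ *ᵥ x s) ⬝ᵥ q (s + τ))
      (g := fun s => ‖(A₁ *ᵥ x s) ⬝ᵥ q (s + τ)‖) (by simpa using (hdot hx1 hq1).norm)
      fun _ _ _ => le_rfl
    simpa [hP] using (hdot hx0 hq0).add h2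
  have h0 : P 0 = 0 := by
    refine tendsto_nhds_unique (tendsto_const_nhds.congr' ?_) hlim
    filter_upwards [eventually_ge_atTop 0] with t ht using (hconst t ht).symm
  simpa [hP] using h0

/-- The derivative of the Lyapunov functional in its first argument: the pairing of `U` with the
segment of `y` on `[t - τ, t]`. It turns solutions of the delay equation into solutions of the
adjoint equation. -/
noncomputable def costate (A₁ : Matrix (Fin n) (Fin n) ℝ) (τ : ℝ)
    (U : ℝ → Matrix (Fin n) (Fin n) ℝ) (y : ℝ → Fin n → ℝ) (t : ℝ) : Fin n → ℝ :=
  U 0 *ᵥ y t + ∫ s in (t - τ)..t, U (t - τ - s) *ᵥ (A₁ *ᵥ y s)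

variable {U V : ℝ → Matrix (Fin n) (Fin n) ℝ} {y : ℝ → Fin n → ℝ}

theorem continuous_mulVec_kernel (hU : Continuous U) (hyc : Continuous y) (r : ℝ) :
    Continuous fun s => U (r - s) *ᵥ (A₁ *ᵥ y s) :=
  Continuous.matrix_mulVec (by fun_prop) (continuous_const.matrix_mulVec hyc)

theorem continuous_costate (hU : Continuous U) (hyc : Continuous y) :
    Continuous (costate A₁ τ U y) := by
  have h : costate A₁ τ U y
      = fun t => U 0 *ᵥ y t + ∫ s in (-τ)..0, U (-τ - s) *ᵥ (A₁ *ᵥ y (s + t)) := by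
    funext t
    rw [costate]
    congr 1
    have := intervalIntegral.integral_comp_add_right (a := -τ) (b := 0)
      (fun s => U (t - τ - s) *ᵥ (A₁ *ᵥ y s)) t
    rw [neg_add_eq_sub, zero_add] at this
    rw [← this]
    refine intervalIntegral.integral_congr fun s _ => ?_
    rw [show t - τ - (s + t) = -τ - s by ring]
  rw [h]
  refine (continuous_const.matrix_mulVec hyc).add ?_
  refine intervalIntegral.continuous_parametric_intervalIntegral_of_continuous' ?_ _ _
  refine Continuous.matrix_mulVec ?_ (continuous_const.matrix_mulVec ?_)
  · exact hU.comp (continuous_const.sub continuous_snd)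
  · exact hyc.comp (continuous_snd.add continuous_fst)

theorem tendsto_costate (hτ : 0 ≤ τ) (hU : Continuous U) (hy0 : Tendsto y atTop (𝓝 0)) :
    Tendsto (costate A₁ τ U y) atTop (𝓝 0) := by
  let L : Matrix (Fin n) (Fin n) ℝ → (Fin n → ℝ) →L[ℝ] (Fin n → ℝ) :=
    fun B => LinearMap.toContinuousLinearMap B.mulVecLin
  have hL : ∀ B v, ‖B *ᵥ v‖ ≤ ‖L B‖ * ‖v‖ := fun B v => (L B).le_opNorm v
  have hLc : Continuous L :=
    LinearMap.continuous_of_finiteDimensional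
      ((LinearMap.toContinuousLinearMap : ((Fin n → ℝ) →ₗ[ℝ] (Fin n → ℝ)) ≃ₗ[ℝ] _).toLinearMap.comp
        (Matrix.mulVecBilin ℝ ℝ))
  have h1 : Tendsto (fun t => U 0 *ᵥ y t) atTop (𝓝 0) := by
    have := ((L (U 0)).continuous.tendsto 0).comp hy0
    rwa [map_zero] at this
  obtain ⟨C, hC⟩ := (isCompact_Icc (a := -τ) (b := 0)).exists_bound_of_continuousOn
    (hLc.comp hU).continuousOn
  have h2 : Tendsto (fun s => C * (‖L A₁‖ * ‖y s‖)) atTop (𝓝 0) := by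
    simpa using (hy0.norm.const_mul ‖L A₁‖).const_mul C
  have h3 := tendsto_integral_window hτ (k := fun t s => U (t - τ - s) *ᵥ (A₁ *ᵥ y s)) h2 ?_
  · rw [← add_zero (0 : Fin n → ℝ)]
    exact h1.add h3
  · intro t s hs
    refine (hL _ _).trans ?_
    have hc := hC (t - τ - s) ⟨by linarith [hs.2], by linarith [hs.1]⟩
    exact mul_le_mul hc (hL _ _) (norm_nonneg _) ((norm_nonneg _).trans hc)

/-- The costate at time `r` may be computed from any segment of `y` ending at `t ∈ [r - τ, r]`:
the right-hand side does not depend on `t`. -/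
theorem costate_eq (hU : ∀ r i j, HasDerivAt (fun r => U r i j) (V r i j) r)
    (hV : ∀ r ∈ Icc 0 τ, V r = U r * A₀ + U (r - τ) * A₁) (hyc : Continuous y)
    (hy : ∀ t, 0 ≤ t → HasDerivWithinAt y (A₀ *ᵥ y t + A₁ *ᵥ y (t - τ)) (Ici t) t)
    {t r : ℝ} (ht : 0 ≤ t) (hr : r ∈ Icc t (t + τ)) :
    costate A₁ τ U y r = U (r - t) *ᵥ y t + ∫ s in (t - τ)..t, U (r - τ - s) *ᵥ (A₁ *ᵥ y s) := by
  have hUc : Continuous U := continuous_matrix fun i j =>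
    continuous_iff_continuousAt.2 fun r => (hU r i j).continuousAt
  have hk := continuous_mulVec_kernel (A₁ := A₁) hUc hyc (r - τ)
  have key := constant_of_has_deriv_right_zero (a := t) (b := r)
    (f := fun t => U (r - t) *ᵥ y t + ∫ s in (t - τ)..t, U (r - τ - s) *ᵥ (A₁ *ᵥ y s)) ?_ ?_ r
    ⟨hr.1, le_rfl⟩
  · simpa [costate] using key
  · refine Continuous.continuousOn (Continuous.add ?_ ?_)
    · exact Continuous.matrix_mulVec (by fun_prop) hyc
    · exact continuous_iff_continuousAt.2 fun t => (hasDerivAt_integral_window hk τ t).continuousAt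
  · intro u hu
    have hUu : ∀ i j, HasDerivWithinAt (fun t => U (r - t) i j) ((-V (r - u)) i j) (Ici u) u :=
      fun i j => ((hU (r - u) i j).comp_const_sub r u).hasDerivWithinAt
    refine ((hasDerivWithinAt_mulVec hUu (hy u (ht.trans hu.1))).add
      (hasDerivAt_integral_window hk τ u).hasDerivWithinAt).congr_deriv ?_
    rw [hV (r - u) ⟨by linarith [hu.2], by linarith [hu.1, hr.2]⟩]
    rw [show r - τ - (u - τ) = r - u by ring, show r - u - τ = r - τ - u by ring]
    simp only [neg_mulVec, add_mulVec, mulVec_add, mulVec_mulVec]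
    abel

/-- Along a solution of the delay equation the costate solves the adjoint equation. -/
theorem hasDerivWithinAt_costate (hτ : 0 ≤ τ)
    (hU : ∀ r i j, HasDerivAt (fun r => U r i j) (V r i j) r) (hVc : Continuous V)
    (hV : ∀ r ∈ Icc 0 τ, V r = U r * A₀ + U (r - τ) * A₁)
    (hV' : ∀ r ∈ Icc (-τ) 0, V r = -(A₀ᵀ * U r) - A₁ᵀ * U (r + τ)) (hyc : Continuous y)
    (hy : ∀ t, 0 ≤ t → HasDerivWithinAt y (A₀ *ᵥ y t + A₁ *ᵥ y (t - τ)) (Ici t) t)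
    {t : ℝ} (ht : 0 ≤ t) :
    HasDerivWithinAt (costate A₁ τ U y)
      (-(A₀ᵀ *ᵥ costate A₁ τ U y t) - A₁ᵀ *ᵥ costate A₁ τ U y (t + τ)) (Ici t) t := by
  have hUc : Continuous U := continuous_matrix fun i j =>
    continuous_iff_continuousAt.2 fun r => (hU r i j).continuousAt
  rcases hτ.eq_or_lt with rfl | hτ'
  · have hq : costate A₁ 0 U y = fun t => U 0 *ᵥ y t := by
      funext t
      simp [costate]
    have h1 := hasDerivWithinAt_mulVec (A := fun _ => U 0) (A' := 0)
      (fun i j => hasDerivWithinAt_const _ _ _) (hy t ht)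
    rw [hq]
    refine h1.congr_deriv ?_
    have e := (hV 0 (by simp)).symm.trans (hV' 0 (by simp))
    have e' := congrArg (fun B => B *ᵥ y t) e
    simpa [add_mulVec, sub_mulVec, neg_mulVec, mulVec_add, mulVec_mulVec] using e'
  · have hk := continuous_mulVec_kernel (A₁ := A₁) hUc hyc
    have h1 : HasDerivAt
        (fun r => U (r - t) *ᵥ y t + ∫ s in (t - τ)..t, U (r - τ - s) *ᵥ (A₁ *ᵥ y s))
        (V (t - t) *ᵥ y t + ∫ s in (t - τ)..t, V (t - τ - s) *ᵥ (A₁ *ᵥ y s)) t := by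
      refine HasDerivAt.add ?_ (hasDerivAt_integral_of_continuous
        (F := fun r s => U (r - τ - s) *ᵥ (A₁ *ᵥ y s))
        (F' := fun r s => V (r - τ - s) *ᵥ (A₁ *ᵥ y s)) ?_ ?_ ?_ _ _ _)
      · have := hasDerivWithinAt_mulVec (s := univ) (A := fun r => U (r - t)) (v := fun _ => y t)
          (fun i j => ((hU (t - t) i j).comp_sub_const t t).hasDerivWithinAt)
          (hasDerivWithinAt_const t univ (y t))
        simpa using this
      · exact fun r => hk (r - τ)
      · refine Continuous.matrix_mulVec ?_ (continuous_const.matrix_mulVec ?_)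
        · exact hVc.comp ((continuous_fst.sub continuous_const).sub continuous_snd)
        · exact hyc.comp continuous_snd
      · intro r s
        have h2 : ∀ i j,
            HasDerivWithinAt (fun r => U (r - τ - s) i j) (V (r - τ - s) i j) univ r := by
          intro i j
          have := ((hU (r - τ - s) i j).comp_sub_const (r - τ) s).comp_sub_const r τ
          exact this.hasDerivWithinAt
        have := hasDerivWithinAt_mulVec h2 (hasDerivWithinAt_const r univ (A₁ *ᵥ y s))
        simpa using this
    have heq : ∀ r ∈ Icc t (t + τ), costate A₁ τ U y r
        = U (r - t) *ᵥ y t + ∫ s in (t - τ)..t, U (r - τ - s) *ᵥ (A₁ *ᵥ y s) :=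
      fun r hr => costate_eq hU hV hyc hy ht hr
    refine ((h1.hasDerivWithinAt (s := Ici t)).congr_of_eventuallyEq ?_
      (heq t ⟨le_rfl, by linarith⟩)).congr_deriv ?_
    · filter_upwards [Icc_mem_nhdsGE (show t < t + τ by linarith)] with r hr using heq r hr
    · rw [heq (t + τ) ⟨by linarith, le_rfl⟩, heq t ⟨le_rfl, by linarith⟩]
      simp only [sub_self, add_sub_cancel_left, add_sub_cancel_right]
      have hint : ∫ s in (t - τ)..t, V (t - τ - s) *ᵥ (A₁ *ᵥ y s)
          = ∫ s in (t - τ)..t, (-(A₀ᵀ *ᵥ (U (t - τ - s) *ᵥ (A₁ *ᵥ y s)))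
            - A₁ᵀ *ᵥ (U (t - s) *ᵥ (A₁ *ᵥ y s))) := by
        refine intervalIntegral.integral_congr fun s hs => ?_
        rw [uIcc_of_le (by linarith)] at hs
        rw [hV' _ ⟨by linarith [hs.2], by linarith [hs.1]⟩, show t - τ - s + τ = t - s by ring,
          sub_mulVec, neg_mulVec, ← mulVec_mulVec, ← mulVec_mulVec]
      have hc : ∀ (B : Matrix (Fin n) (Fin n) ℝ) (r : ℝ),
          Continuous fun s => B *ᵥ (U (r - s) *ᵥ (A₁ *ᵥ y s)) :=
        fun B r => continuous_const.matrix_mulVec (hk r)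
      have hneg : Continuous fun s => -(A₀ᵀ *ᵥ (U (t - τ - s) *ᵥ (A₁ *ᵥ y s))) :=
        (hc A₀ᵀ (t - τ)).neg
      rw [hint, intervalIntegral.integral_sub (hneg.intervalIntegrable _ _)
        ((hc _ _).intervalIntegrable _ _), intervalIntegral.integral_neg,
        ← mulVec_integral _ (hk _), ← mulVec_integral _ (hk _),
        hV' 0 ⟨by linarith, le_rfl⟩]
      simp only [zero_add, sub_mulVec, neg_mulVec, mulVec_add, mulVec_mulVec]
      abel

section

attribute [local instance] Matrix.normedAddCommGroup Matrix.normedSpace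

theorem hasDerivWithinAt_matrix_iff {𝕜 : Type*} [NormedAddCommGroup 𝕜] [NormedSpace ℝ 𝕜]
    {B : ℝ → Matrix (Fin n) (Fin n) 𝕜} {B' : Matrix (Fin n) (Fin n) 𝕜} {s : Set ℝ} {t : ℝ} :
    HasDerivWithinAt B B' s t ↔ ∀ i j, HasDerivWithinAt (fun r => B r i j) (B' i j) s t :=
  hasDerivWithinAt_pi.trans (forall_congr' fun _ => hasDerivWithinAt_pi)

theorem hasDerivAt_matrix_iff {𝕜 : Type*} [NormedAddCommGroup 𝕜] [NormedSpace ℝ 𝕜]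
    {B : ℝ → Matrix (Fin n) (Fin n) 𝕜} {B' : Matrix (Fin n) (Fin n) 𝕜} {t : ℝ} :
    HasDerivAt B B' t ↔ ∀ i j, HasDerivAt (fun r => B r i j) (B' i j) t :=
  hasDerivAt_pi.trans (forall_congr' fun _ => hasDerivAt_pi)

/-- A solution of `B' = B A₀` with `B 0 = 0` vanishes. -/
theorem eqOn_zero_of_hasDerivAt_mul {B : ℝ → Matrix (Fin n) (Fin n) ℝ} {T : ℝ} (h0 : B 0 = 0)
    (hB : ∀ t ∈ Icc 0 T, HasDerivAt B (B t * A₀) t) : ∀ t ∈ Icc 0 T, B t = 0 := by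
  refine linearODE_unique (LinearMap.toContinuousLinearMap (LinearMap.mulRight ℝ A₀)) T B
    (fun _ => 0) h0 (fun t ht => (hB t ht).hasDerivWithinAt) fun t _ => ?_
  exact (hasDerivWithinAt_const t _ 0).congr_deriv (zero_mul A₀).symm

end

/-- Under exponential stability, a `C¹` function that satisfies both forms of the homogeneous
delay Lyapunov equation vanishes. The pairing of two arbitrary solutions with `U` is zero, and
varying their initial functions gives `U 0 = 0` and `U A₁ = 0`, so that `U' = U A₀`. -/
theorem eq_zero_of_homogeneous (hτ : 0 ≤ τ) (hstab : ExponentiallyStable A₀ A₁ τ)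
    (hU : ∀ r, HasDerivAt U (V r) r) (hVc : Continuous V)
    (hV : ∀ r ∈ Icc 0 τ, V r = U r * A₀ + U (r - τ) * A₁)
    (hV' : ∀ r ∈ Icc (-τ) 0, V r = -(A₀ᵀ * U r) - A₁ᵀ * U (r + τ)) :
    ∀ r ∈ Icc 0 τ, U r = 0 := by
  have hUe : ∀ r i j, HasDerivAt (fun r => U r i j) (V r i j) r := fun r i j =>
    hasDerivAt_matrix_iff.1 (hU r) i j
  have hUc : Continuous U := continuous_matrix fun i j =>
    continuous_iff_continuousAt.2 fun r => (hUe r i j).continuousAt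
  have hcost : ∀ ψ : ℝ → Fin n → ℝ, Continuous ψ →
      U 0 *ᵥ ψ 0 + ∫ s in (-τ)..0, U (-τ - s) *ᵥ (A₁ *ᵥ ψ s) = 0 := by
    intro ψ hψ
    obtain ⟨y, hyc, hyψ, hy, hy0⟩ := exists_tendsto_zero_solution hτ hstab hψ
    have hqc := continuous_costate (A₁ := A₁) (τ := τ) hUc hyc
    have h1 : costate A₁ τ U y 0 = 0 := by
      refine (eq_zero_of_forall_dotProduct_add_integral hτ
        (b := fun s => A₁ᵀ *ᵥ costate A₁ τ U y (s + τ))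
        (continuous_const.matrix_mulVec (by fun_prop)) fun φ hφ => ?_).1
      obtain ⟨x, hxc, hxφ, hx, hx0⟩ := exists_tendsto_zero_solution hτ hstab hφ
      refine Eq.trans ?_ (pairing_eq_zero hτ hxc hqc hx
        (fun t ht => hasDerivWithinAt_costate hτ hUe hVc hV hV' hyc hy ht) hx0
        (tendsto_costate hτ hUc hy0))
      rw [hxφ 0 le_rfl, dotProduct_comm (φ 0)]
      congr 1
      refine intervalIntegral.integral_congr fun s hs => ?_
      rw [uIcc_of_le (by linarith)] at hs
      rw [hxφ s hs.2, dotProduct_comm, dotProduct_mulVec, vecMul_transpose]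
    rw [← h1, costate, hyψ 0 le_rfl, zero_sub]
    congr 1
    refine intervalIntegral.integral_congr fun s hs => ?_
    rw [uIcc_of_le (by linarith)] at hs
    rw [hyψ s hs.2]
  have hrow : ∀ i, U 0 i = 0 ∧ (0 < τ → ∀ s ∈ Icc (-τ) 0, (U (-τ - s) * A₁) i = 0) := by
    intro i
    refine eq_zero_of_forall_dotProduct_add_integral hτ (b := fun s => (U (-τ - s) * A₁) i) ?_
      fun ψ hψ => ?_
    · exact (continuous_apply i).comp (Continuous.matrix_mul (by fun_prop) continuous_const)
    · have h1 := congrFun (hcost ψ hψ) i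
      have h2 := (ContinuousLinearMap.proj (R := ℝ) (φ := fun _ : Fin n => ℝ) i
        ).intervalIntegral_comp_comm (μ := MeasureTheory.volume)
        ((continuous_mulVec_kernel (A₁ := A₁) hUc hψ (-τ)).intervalIntegrable (-τ) 0)
      simp only [ContinuousLinearMap.proj_apply] at h2
      rw [Pi.add_apply, ← h2] at h1
      simp only [mulVec_mulVec] at h1
      exact h1
  have h0 : U 0 = 0 := funext fun i => (hrow i).1
  rcases hτ.eq_or_lt with rfl | hτ'
  · intro r hr
    rw [le_antisymm hr.2 hr.1, h0]
  · refine eqOn_zero_of_hasDerivAt_mul (A₀ := A₀) h0 fun t ht => ?_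
    have h1 : U (t - τ) * A₁ = 0 := funext fun i => by
      have := (hrow i).2 hτ' (-t) ⟨by linarith [ht.2], by linarith [ht.1]⟩
      rwa [show -τ - -t = t - τ by ring] at this
    have h2 := hU t
    rwa [hV t ht, h1, add_zero] at h2

end Homogeneous

section Reflection

variable {n : ℕ} {A₀ A₁ W : Matrix (Fin n) (Fin n) ℝ} {τ : ℝ}

attribute [local instance] Matrix.normedAddCommGroup Matrix.normedSpace

/-! ### The reflection equation -/

/-- `G'(t) = G(t) A₀ + G(-t)ᵀ A₁` on the whole line. The coupled initial value problem is this
equation for `Z₁(t) = G(t)` and `Z₂(t) = G(-t)`, and `U(t) = G(t - τ/2)` on `[0, τ]` for solutions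
`U` of the delay Lyapunov equation. -/
def IsReflectionSolution (A₀ A₁ : Matrix (Fin n) (Fin n) ℝ) (G : ℝ → Matrix (Fin n) (Fin n) ℝ) :
    Prop :=
  ∀ t, HasDerivAt G (G t * A₀ + (G (-t))ᵀ * A₁) t

theorem hasDerivAt_transpose {B : ℝ → Matrix (Fin n) (Fin n) ℝ} {B' : Matrix (Fin n) (Fin n) ℝ}
    {t : ℝ} (h : HasDerivAt B B' t) : HasDerivAt (fun r => (B r)ᵀ) B'ᵀ t :=
  hasDerivAt_matrix_iff.2 fun i j => hasDerivAt_matrix_iff.1 h j i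

/-- Existence of solutions: exchanging the components and reversing time is a symmetry of the
coupled system and fixes the initial value `(X, X)`, so the two components are reflections of each
other. -/
theorem exists_isReflectionSolution (A₀ A₁ X : Matrix (Fin n) (Fin n) ℝ) :
    ∃ G, G 0 = X ∧ IsReflectionSolution A₀ A₁ G := by
  obtain ⟨z, h0, hz⟩ := linearODE_exists (LinearMap.toContinuousLinearMap (coupledRHS A₀ A₁)) (X, X)
  have h1 : ∀ t, HasDerivAt (fun t => (z t).1) ((z t).1 * A₀ + (z t).2ᵀ * A₁) t := fun t =>
    (ContinuousLinearMap.fst ℝ (Matrix (Fin n) (Fin n) ℝ)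
      (Matrix (Fin n) (Fin n) ℝ)).hasFDerivAt.comp_hasDerivAt t (hz t)
  have h2 : ∀ t, HasDerivAt (fun t => (z t).2) (-((z t).1ᵀ * A₁) - (z t).2 * A₀) t := fun t =>
    (ContinuousLinearMap.snd ℝ (Matrix (Fin n) (Fin n) ℝ)
      (Matrix (Fin n) (Fin n) ℝ)).hasFDerivAt.comp_hasDerivAt t (hz t)
  have h1n : ∀ t, HasDerivAt (fun t => (z (-t)).1) (-((z (-t)).2ᵀ * A₁) - (z (-t)).1 * A₀) t := by
    intro t
    have := (h1 (-t)).scomp t (hasDerivAt_neg t)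
    refine this.congr_deriv ?_
    rw [neg_smul, one_smul, neg_add_rev]
    rfl
  have h2n : ∀ t, HasDerivAt (fun t => (z (-t)).2) ((z (-t)).2 * A₀ + (z (-t)).1ᵀ * A₁) t := by
    intro t
    have := (h2 (-t)).scomp t (hasDerivAt_neg t)
    refine this.congr_deriv ?_
    rw [neg_smul, one_smul, neg_sub, sub_neg_eq_add]
  have hswap : ∀ t, 0 ≤ t → (z (-t)).2 = (z t).1 ∧ (z (-t)).1 = (z t).2 := by
    intro t ht
    have := IsCoupledSolution.unique (T := t) (X := X)
      (Z₁ := fun t => (z (-t)).2) (Z₂ := fun t => (z (-t)).1)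
      (Y₁ := fun t => (z t).1) (Y₂ := fun t => (z t).2)
      ⟨by simp [h0], by simp [h0], fun s _ => (h2n s).hasDerivWithinAt,
        fun s _ => (h1n s).hasDerivWithinAt⟩
      ⟨by simp [h0], by simp [h0], fun s _ => (h1 s).hasDerivWithinAt,
        fun s _ => (h2 s).hasDerivWithinAt⟩
    exact ⟨this.1 ⟨ht, le_rfl⟩, this.2 ⟨ht, le_rfl⟩⟩
  refine ⟨fun t => (z t).1, by simp [h0], fun t => ?_⟩
  have h3 : (z (-t)).1 = (z t).2 := by
    rcases le_total 0 t with ht | ht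
    · exact (hswap t ht).2
    · have := (hswap (-t) (by linarith)).1
      rw [neg_neg] at this
      exact this.symm
  simp only [h3]
  exact h1 t

namespace IsReflectionSolution

variable {G : ℝ → Matrix (Fin n) (Fin n) ℝ}

theorem continuous (hG : IsReflectionSolution A₀ A₁ G) : Continuous G :=
  continuous_iff_continuousAt.2 fun t => (hG t).continuousAt

theorem hasDerivAt_neg (hG : IsReflectionSolution A₀ A₁ G) (t : ℝ) :
    HasDerivAt (fun t => G (-t)) (-((G t)ᵀ * A₁) - G (-t) * A₀) t := by
  refine ((hG (-t)).scomp t (_root_.hasDerivAt_neg t)).congr_deriv ?_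
  rw [neg_smul, one_smul, neg_add_rev, neg_neg]
  rfl

theorem isCoupledSolution (hG : IsReflectionSolution A₀ A₁ G) (T : ℝ) :
    IsCoupledSolution A₀ A₁ T (G 0) G (fun t => G (-t)) :=
  ⟨rfl, by simp, fun t _ => (hG t).hasDerivWithinAt,
    fun t _ => (hG.hasDerivAt_neg t).hasDerivWithinAt⟩

theorem Lop_eq (hG : IsReflectionSolution A₀ A₁ G) (hτ : 0 ≤ τ) (c : ℝ) :
    Lop A₀ A₁ τ c (G 0) = boundaryExpr A₀ A₁ c (G (τ / 2)) (G (-(τ / 2))) :=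
  DelayLyapunov.Lop_eq hτ c (hG.isCoupledSolution (τ / 2))

end IsReflectionSolution

/-! ### The operator `L_c` -/

/-- For `c ≠ 0` the skew-symmetric part of the boundary expression controls that of `Z₂`. -/
theorem isSymm_of_boundaryExpr {c : ℝ} (hc : c ≠ 0) {Z₁ Z₂ : Matrix (Fin n) (Fin n) ℝ}
    (h : (boundaryExpr A₀ A₁ c Z₁ Z₂).IsSymm) : Z₂.IsSymm := by
  have h1 : (boundaryExpr A₀ A₁ c Z₁ Z₂)ᵀ - boundaryExpr A₀ A₁ c Z₁ Z₂
      = (2 * c) • (Z₂ᵀ - Z₂) := by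
    simp only [boundaryExpr, transpose_add, transpose_sub, transpose_mul, transpose_transpose,
      transpose_smul, add_mul, mul_sub, mul_smul_comm, smul_mul_assoc, mul_one, one_mul,
      mul_smul, two_smul, smul_sub]
    abel
  rw [h.eq, sub_self, eq_comm, smul_eq_zero] at h1
  exact sub_eq_zero.1 (h1.resolve_left (by simpa using hc))

theorem boundaryExpr_of_isSymm (c : ℝ) {Z₁ Z₂ : Matrix (Fin n) (Fin n) ℝ} (h : Z₂.IsSymm) :
    boundaryExpr A₀ A₁ c Z₁ Z₂ = Z₂ * A₀ + A₀ᵀ * Z₂ + Z₁ᵀ * A₁ + A₁ᵀ * Z₁ := by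
  rw [boundaryExpr, h.eq]
  simp only [add_mul, mul_sub, mul_smul_comm, smul_mul_assoc, mul_one, one_mul]
  abel

theorem boundaryExpr_add (c : ℝ) (Z₁ Z₂ Y₁ Y₂ : Matrix (Fin n) (Fin n) ℝ) :
    boundaryExpr A₀ A₁ c (Z₁ + Y₁) (Z₂ + Y₂)
      = boundaryExpr A₀ A₁ c Z₁ Z₂ + boundaryExpr A₀ A₁ c Y₁ Y₂ := by
  simp only [boundaryExpr, transpose_add, add_mul _ _ A₁, add_mul _ _ (A₀ - _), mul_add _ Z₁,
    mul_add _ Z₂]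
  abel

theorem boundaryExpr_smul (c r : ℝ) (Z₁ Z₂ : Matrix (Fin n) (Fin n) ℝ) :
    boundaryExpr A₀ A₁ c (r • Z₁) (r • Z₂) = r • boundaryExpr A₀ A₁ c Z₁ Z₂ := by
  simp only [boundaryExpr, transpose_smul, smul_mul_assoc, mul_smul_comm, smul_add]

/-- `L_c` as a linear map. -/
noncomputable def LopLinear (A₀ A₁ : Matrix (Fin n) (Fin n) ℝ) {τ : ℝ} (hτ : 0 ≤ τ) (c : ℝ) :
    Matrix (Fin n) (Fin n) ℝ →ₗ[ℝ] Matrix (Fin n) (Fin n) ℝ where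
  toFun := Lop A₀ A₁ τ c
  map_add' X Y := by
    obtain ⟨G, rfl, hG⟩ := exists_isReflectionSolution A₀ A₁ X
    obtain ⟨H, rfl, hH⟩ := exists_isReflectionSolution A₀ A₁ Y
    have hGH : IsReflectionSolution A₀ A₁ (G + H) := fun t => by
      refine ((hG t).add (hH t)).congr_deriv ?_
      simp only [Pi.add_apply, transpose_add, add_mul]
      abel
    rw [hG.Lop_eq hτ, hH.Lop_eq hτ, ← boundaryExpr_add]
    exact hGH.Lop_eq hτ c
  map_smul' r X := by
    obtain ⟨G, rfl, hG⟩ := exists_isReflectionSolution A₀ A₁ X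
    have hrG : IsReflectionSolution A₀ A₁ (r • G) := fun t => by
      refine ((hG t).const_smul r).congr_deriv ?_
      simp only [Pi.smul_apply, transpose_smul, smul_mul_assoc, smul_add]
    rw [hG.Lop_eq hτ, RingHom.id_apply, ← boundaryExpr_smul]
    exact hrG.Lop_eq hτ c

/-! ### From the reflection equation to the delay Lyapunov equation -/

/-- The function with `U(r) = G(r - τ/2)` for `r ≥ 0`, continued by `U(-r) = U(r)ᵀ`. -/
noncomputable def unfoldReflection (τ : ℝ) (G : ℝ → Matrix (Fin n) (Fin n) ℝ) (r : ℝ) :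
    Matrix (Fin n) (Fin n) ℝ :=
  if 0 ≤ r then G (r - τ / 2) else (G (-r - τ / 2))ᵀ

theorem unfoldReflection_of_nonneg {G : ℝ → Matrix (Fin n) (Fin n) ℝ} {r : ℝ} (hr : 0 ≤ r) :
    unfoldReflection τ G r = G (r - τ / 2) := if_pos hr

theorem unfoldReflection_of_nonpos {G : ℝ → Matrix (Fin n) (Fin n) ℝ}
    (hsymm : (G (-(τ / 2))).IsSymm) {r : ℝ} (hr : r ≤ 0) :
    unfoldReflection τ G r = (G (-r - τ / 2))ᵀ := by
  unfold unfoldReflection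
  split_ifs with h
  · rw [le_antisymm hr h, neg_zero, zero_sub, hsymm.eq]
  · rfl

/-- `L_c` is injective: a kernel element gives a solution of the homogeneous delay Lyapunov
equation, which is continuously differentiable across `0` because the algebraic condition with
`W = 0` says that its one-sided derivatives at `0` agree. -/
theorem eq_zero_of_Lop_eq_zero (hτ : 0 ≤ τ) (hstab : ExponentiallyStable A₀ A₁ τ) {c : ℝ}
    (hc : c ≠ 0) {X : Matrix (Fin n) (Fin n) ℝ} (hX : Lop A₀ A₁ τ c X = 0) : X = 0 := by
  obtain ⟨G, rfl, hG⟩ := exists_isReflectionSolution A₀ A₁ X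
  rw [hG.Lop_eq hτ] at hX
  have hsymm : (G (-(τ / 2))).IsSymm := isSymm_of_boundaryExpr hc (by rw [hX]; exact isSymm_zero)
  rw [boundaryExpr_of_isSymm c hsymm] at hX
  have hGc := hG.continuous
  set f' : ℝ → Matrix (Fin n) (Fin n) ℝ := fun r => G (r - τ / 2) * A₀ + (G (τ / 2 - r))ᵀ * A₁
    with hf'
  set g' : ℝ → Matrix (Fin n) (Fin n) ℝ := fun r =>
    -(A₀ᵀ * (G (-r - τ / 2))ᵀ) - A₁ᵀ * G (r + τ / 2) with hg'
  have hf : ∀ r, HasDerivAt (fun r => G (r - τ / 2)) (f' r) r := fun r => by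
    have := (hG (r - τ / 2)).comp_sub_const r (τ / 2)
    rwa [neg_sub] at this
  have hg : ∀ r, HasDerivAt (fun r => (G (-r - τ / 2))ᵀ) (g' r) r := fun r => by
    have := hasDerivAt_transpose ((hG.hasDerivAt_neg (r + τ / 2)).comp_add_const r (τ / 2))
    simp only [neg_add', transpose_sub, transpose_neg, transpose_mul, transpose_transpose] at this
    exact this.congr_deriv (neg_sub_comm _ _)
  have hfg' : f' 0 = g' 0 := by
    rw [hf', hg', ← sub_eq_zero]
    simp only [zero_sub, sub_zero, neg_zero, zero_add, hsymm.eq]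
    rw [← hX]
    abel
  have hfc : Continuous f' := by
    refine Continuous.add ?_ ?_
    · exact Continuous.matrix_mul (by fun_prop) continuous_const
    · exact Continuous.matrix_mul (Continuous.matrix_transpose (by fun_prop)) continuous_const
  have hgc : Continuous g' := by
    refine Continuous.sub (Continuous.neg ?_) ?_
    · exact Continuous.matrix_mul continuous_const (Continuous.matrix_transpose (by fun_prop))
    · exact Continuous.matrix_mul continuous_const (by fun_prop)
  have hz := eq_zero_of_homogeneous hτ hstab (U := unfoldReflection τ G)
    (V := fun r => if 0 ≤ r then f' r else g' r)
    (hasDerivAt_ite_nonneg hf hg (by simp [hsymm.eq]) hfg')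
    (Continuous.if_le hfc hgc continuous_const continuous_id (by rintro _ rfl; exact hfg')) ?_ ?_
    (τ / 2) ⟨by linarith, by linarith⟩
  · rwa [unfoldReflection_of_nonneg (by linarith), sub_self] at hz
  · intro r hr
    rw [if_pos hr.1, unfoldReflection_of_nonneg hr.1,
      unfoldReflection_of_nonpos hsymm (by linarith [hr.2]),
      show -(r - τ) - τ / 2 = τ / 2 - r by ring]
  · intro r hr
    have h1 : (if 0 ≤ r then f' r else g' r) = g' r := by
      split_ifs with h
      · rw [le_antisymm hr.2 h, hfg']
      · rfl
    rw [h1, unfoldReflection_of_nonpos hsymm hr.2, unfoldReflection_of_nonneg (by linarith [hr.1]),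
      show r + τ - τ / 2 = r + τ / 2 by ring]

theorem Lop_injective (hτ : 0 ≤ τ) (hstab : ExponentiallyStable A₀ A₁ τ) {c : ℝ} (hc : c ≠ 0) :
    Function.Injective (LopLinear A₀ A₁ hτ c) :=
  (injective_iff_map_eq_zero _).2 fun _ hX => eq_zero_of_Lop_eq_zero hτ hstab hc hX

/-- The delay Lyapunov equation for a real-valued function. -/
structure IsRealLyapunovSolution (A₀ A₁ W : Matrix (Fin n) (Fin n) ℝ) (τ : ℝ)
    (U : ℝ → Matrix (Fin n) (Fin n) ℝ) : Prop where
  continuousOn : ContinuousOn U (Icc (-τ) τ)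
  hasDeriv : ∀ t ∈ Ioc 0 τ,
    HasDerivWithinAt U (U t * A₀ + U (t - τ) * A₁) (Icc (-τ) τ) t
  symm : ∀ t ∈ Icc (-τ) τ, U (-t) = (U t)ᵀ
  algebraic : -W = U 0 * A₀ + A₀ᵀ * U 0 + (U τ)ᵀ * A₁ + A₁ᵀ * U τ

theorem IsReflectionSolution.isRealLyapunovSolution {G : ℝ → Matrix (Fin n) (Fin n) ℝ}
    (hG : IsReflectionSolution A₀ A₁ G) (hτ : 0 ≤ τ) {c : ℝ} (hc : c ≠ 0) (hW : W.IsSymm)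
    (hL : Lop A₀ A₁ τ c (G 0) = -W) :
    IsRealLyapunovSolution A₀ A₁ W τ (unfoldReflection τ G) := by
  rw [hG.Lop_eq hτ] at hL
  have hsymm : (G (-(τ / 2))).IsSymm := isSymm_of_boundaryExpr hc (by rw [hL]; exact hW.neg)
  rw [boundaryExpr_of_isSymm c hsymm] at hL
  have hGc := hG.continuous
  refine ⟨Continuous.continuousOn ?_, fun t ht => ?_, fun t _ => ?_, ?_⟩
  · refine Continuous.if_le (by fun_prop) (Continuous.matrix_transpose (by fun_prop))
      continuous_const continuous_id ?_
    rintro _ rfl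
    simp [hsymm.eq]
  · have h1 : HasDerivAt (fun r => G (r - τ / 2))
        (G (t - τ / 2) * A₀ + (G (-(t - τ / 2)))ᵀ * A₁) t :=
      (hG (t - τ / 2)).comp_sub_const t (τ / 2)
    rw [unfoldReflection_of_nonneg ht.1.le, unfoldReflection_of_nonpos hsymm (by linarith [ht.2]),
      show -(t - τ) - τ / 2 = -(t - τ / 2) by ring]
    refine (h1.congr_of_eventuallyEq ?_).hasDerivWithinAt
    filter_upwards [Ioi_mem_nhds ht.1] with s hs using unfoldReflection_of_nonneg (le_of_lt hs)
  · rcases le_total 0 t with h | h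
    · rw [unfoldReflection_of_nonneg h, unfoldReflection_of_nonpos hsymm (by linarith), neg_neg]
    · rw [unfoldReflection_of_nonpos hsymm h, unfoldReflection_of_nonneg (by linarith),
        transpose_transpose]
  · rw [unfoldReflection_of_nonneg le_rfl, unfoldReflection_of_nonneg hτ, ← hL, zero_sub,
      show τ - τ / 2 = τ / 2 by ring]

namespace IsRealLyapunovSolution

variable {G U : ℝ → Matrix (Fin n) (Fin n) ℝ}

/-- A solution on `[0, τ]` is determined by its value at the midpoint. Comparing on the half-open
interval `[0, τ/2)` avoids the derivative at `0`, which the equation does not prescribe. -/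
theorem eqOn_reflectionSolution (hU : IsRealLyapunovSolution A₀ A₁ W τ U)
    (hG : IsReflectionSolution A₀ A₁ G) (h0 : G 0 = U (τ / 2)) :
    ∀ t ∈ Icc 0 τ, U t = G (t - τ / 2) := by
  let F : (Matrix (Fin n) (Fin n) ℝ × Matrix (Fin n) (Fin n) ℝ) →L[ℝ]
      (Matrix (Fin n) (Fin n) ℝ × Matrix (Fin n) (Fin n) ℝ) :=
    LinearMap.toContinuousLinearMap (coupledRHS A₀ A₁)
  have hUc : ContinuousOn U (Icc 0 τ) :=
    hU.continuousOn.mono fun s hs => ⟨by linarith [hs.1, hs.2], hs.2⟩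
  have hmain : EqOn (fun t => (U (τ / 2 + t), U (τ / 2 - t))) (fun t => (G t, G (-t)))
      (Icc 0 (τ / 2)) := by
    refine ODE_solution_unique (v := fun _ => F) (fun _ => F.lipschitz) ?_ ?_ ?_ ?_ (by simp [h0])
    · refine ContinuousOn.prodMk ?_ ?_
      · exact hUc.comp (by fun_prop) fun s hs => ⟨by linarith [hs.1, hs.2], by linarith [hs.2]⟩
      · exact hUc.comp (by fun_prop) fun s hs => ⟨by linarith [hs.2], by linarith [hs.1, hs.2]⟩
    · intro t ht
      have hnear : Icc t (τ / 2) ∈ 𝓝[Ici t] t := Icc_mem_nhdsGE ht.2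
      refine HasDerivWithinAt.prodMk ?_ ?_
      · have h1 := (hU.hasDeriv (τ / 2 + t) ⟨by linarith [ht.1, ht.2], by linarith [ht.2]⟩).scomp
          t (s := Icc t (τ / 2)) ((hasDerivWithinAt_id t _).const_add (τ / 2))
          fun s hs => ⟨by linarith [hs.1, hs.2, ht.1], by
            linarith [hs.2]⟩
        refine (h1.mono_of_mem_nhdsWithin hnear).congr_deriv ?_
        rw [one_smul, ← hU.symm (τ / 2 - t) ⟨by linarith [ht.1, ht.2], by linarith [ht.1, ht.2]⟩,
          show -(τ / 2 - t) = τ / 2 + t - τ by ring]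
      · have h1 := (hU.hasDeriv (τ / 2 - t) ⟨by linarith [ht.2], by linarith [ht.1, ht.2]⟩).scomp
          t (s := Icc t (τ / 2)) ((hasDerivWithinAt_id t _).const_sub (τ / 2))
          fun s hs => ⟨by linarith [hs.2, hs.1, ht.1], by
            linarith [hs.1, ht.1, ht.2]⟩
        refine (h1.mono_of_mem_nhdsWithin hnear).congr_deriv ?_
        rw [neg_smul, one_smul, neg_add_rev,
          ← hU.symm (τ / 2 + t) ⟨by linarith [ht.1, ht.2], by linarith [ht.1, ht.2]⟩,
          show -(τ / 2 + t) = τ / 2 - t - τ by ring]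
        rfl
    · exact (hG.continuous.prodMk (hG.continuous.comp continuous_neg)).continuousOn
    · exact fun t _ => (hG t).hasDerivWithinAt.prodMk (hG.hasDerivAt_neg t).hasDerivWithinAt
  intro t ht
  rcases le_total (τ / 2) t with h | h
  · have := congrArg Prod.fst (hmain (x := t - τ / 2) ⟨by linarith, by linarith [ht.2]⟩)
    simpa using this
  · have := congrArg Prod.snd (hmain (x := τ / 2 - t) ⟨by linarith, by linarith [ht.1]⟩)
    simpa using this

theorem Lop_eq (hU : IsRealLyapunovSolution A₀ A₁ W τ U) (hτ : 0 ≤ τ) (c : ℝ) :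
    Lop A₀ A₁ τ c (U (τ / 2)) = -W := by
  obtain ⟨G, h0, hG⟩ := exists_isReflectionSolution A₀ A₁ (U (τ / 2))
  have h := hU.eqOn_reflectionSolution hG h0
  have e0 := h 0 ⟨le_rfl, hτ⟩
  have e1 := h τ ⟨hτ, le_rfl⟩
  rw [zero_sub] at e0
  rw [show τ - τ / 2 = τ / 2 by ring] at e1
  have hsymm : (U 0).IsSymm := by
    have := hU.symm 0 ⟨by linarith, hτ⟩
    rw [neg_zero] at this
    exact this.symm
  rw [← h0, hG.Lop_eq hτ, ← e0, ← e1, boundaryExpr_of_isSymm c hsymm, hU.algebraic]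

theorem unique (hτ : 0 ≤ τ) (hstab : ExponentiallyStable A₀ A₁ τ)
    {V : ℝ → Matrix (Fin n) (Fin n) ℝ} (hU : IsRealLyapunovSolution A₀ A₁ W τ U)
    (hV : IsRealLyapunovSolution A₀ A₁ W τ V) : EqOn V U (Icc (-τ) τ) := by
  have hX : V (τ / 2) = U (τ / 2) := Lop_injective hτ hstab one_ne_zero
    ((hV.Lop_eq hτ 1).trans (hU.Lop_eq hτ 1).symm)
  obtain ⟨G, h0, hG⟩ := exists_isReflectionSolution A₀ A₁ (U (τ / 2))
  have hpos : ∀ t ∈ Icc 0 τ, V t = U t := fun t ht => by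
    rw [hU.eqOn_reflectionSolution hG h0 t ht,
      hV.eqOn_reflectionSolution hG (h0.trans hX.symm) t ht]
  intro t ht
  rcases le_total 0 t with h | h
  · exact hpos t ⟨h, ht.2⟩
  · have hm : -t ∈ Icc (-τ) τ := ⟨by linarith [ht.2], by linarith [ht.1]⟩
    rw [← neg_neg t, hU.symm _ hm, hV.symm _ hm, hpos (-t) ⟨by linarith, hm.2⟩]

end IsRealLyapunovSolution

/-! ### Complex solutions -/

theorem toComplex_apply (B : Matrix (Fin n) (Fin n) ℝ) (i j : Fin n) :
    toComplex B i j = (B i j : ℂ) := rfl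

theorem toComplex_add (B C : Matrix (Fin n) (Fin n) ℝ) :
    toComplex (B + C) = toComplex B + toComplex C := by
  ext i j
  simp [toComplex_apply]

theorem toComplex_mul (B C : Matrix (Fin n) (Fin n) ℝ) :
    toComplex (B * C) = toComplex B * toComplex C := by
  ext i j
  simp [toComplex_apply, mul_apply]

theorem IsRealLyapunovSolution.toComplex {U : ℝ → Matrix (Fin n) (Fin n) ℝ}
    (hU : IsRealLyapunovSolution A₀ A₁ W τ U) :
    IsDelayLyapunovSolution A₀ A₁ W τ fun t => toComplex (U t) := by
  refine ⟨?_, fun t ht => ?_, fun t ht => ?_, ?_⟩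
  · have h : Continuous (DelayLyapunov.toComplex (n := n)) :=
      continuous_id.matrix_map Complex.continuous_ofReal
    exact h.comp_continuousOn hU.continuousOn
  · rw [← toComplex_mul, ← toComplex_mul, ← toComplex_add, hasDerivWithinAt_matrix_iff]
    exact fun i j => (hasDerivWithinAt_matrix_iff.1 (hU.hasDeriv t ht) i j).ofReal_comp
  · simp only [hU.symm t ht]
    rfl
  · have h := congrArg DelayLyapunov.toComplex hU.algebraic
    simp only [toComplex_add, toComplex_mul] at h
    refine Eq.trans ?_ h
    ext i j
    simp [toComplex_apply]

/-- A real-linear functional on `ℂ`, applied entrywise, commutes with right multiplication by a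
real matrix. -/
theorem map_mul_toComplex (f : ℂ →L[ℝ] ℝ) (B : Matrix (Fin n) (Fin n) ℂ)
    (A : Matrix (Fin n) (Fin n) ℝ) : (B * toComplex A).map f = B.map f * A := by
  ext i j
  simp only [map_apply, mul_apply, toComplex_apply, map_sum]
  refine Finset.sum_congr rfl fun k _ => ?_
  rw [mul_comm, ← Complex.real_smul, map_smul, smul_eq_mul, mul_comm]

theorem map_toComplex_transpose_mul (f : ℂ →L[ℝ] ℝ) (B : Matrix (Fin n) (Fin n) ℂ)
    (A : Matrix (Fin n) (Fin n) ℝ) : ((toComplex A)ᵀ * B).map f = Aᵀ * B.map f := by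
  have h := congrArg transpose (map_mul_toComplex f Bᵀ A)
  rwa [← transpose_map, transpose_mul, transpose_transpose, transpose_mul, transpose_map,
    transpose_transpose] at h

/-- Real-linear functionals, such as the real and the imaginary part, map complex solutions to real
ones, with the cost matrix scaled by the value at `1`. -/
theorem IsDelayLyapunovSolution.map {U : ℝ → Matrix (Fin n) (Fin n) ℂ}
    (hU : IsDelayLyapunovSolution A₀ A₁ W τ U) (f : ℂ →L[ℝ] ℝ) :
    IsRealLyapunovSolution A₀ A₁ (f 1 • W) τ fun t => (U t).map f := by
  refine ⟨?_, fun t ht => ?_, fun t ht => ?_, ?_⟩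
  · have h : Continuous fun B : Matrix (Fin n) (Fin n) ℂ => B.map f :=
      continuous_id.matrix_map f.continuous
    exact h.comp_continuousOn hU.continuousOn
  · rw [← map_mul_toComplex, ← map_mul_toComplex, ← Matrix.map_add _ (map_add f),
      hasDerivWithinAt_matrix_iff]
    exact fun i j => f.hasFDerivAt.comp_hasDerivWithinAt t
      (hasDerivWithinAt_matrix_iff.1 (hU.hasDeriv t ht) i j)
  · simp only [hU.symm t ht]
    rfl
  · have h := congrArg (fun B : Matrix (Fin n) (Fin n) ℂ => B.map f) hU.algebraic
    simp only [Matrix.map_add _ (map_add f), map_mul_toComplex, map_toComplex_transpose_mul] at h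
    refine Eq.trans ?_ h
    ext i j
    have h1 := f.map_smul (W i j) 1
    rw [Complex.real_smul, mul_one] at h1
    simp [toComplex_apply, h1, mul_comm]

theorem IsDelayLyapunovSolution.unique (hτ : 0 ≤ τ) (hstab : ExponentiallyStable A₀ A₁ τ)
    {U V : ℝ → Matrix (Fin n) (Fin n) ℂ} (hU : IsDelayLyapunovSolution A₀ A₁ W τ U)
    (hV : IsDelayLyapunovSolution A₀ A₁ W τ V) : EqOn V U (Icc (-τ) τ) := by
  intro t ht
  have h : ∀ f : ℂ →L[ℝ] ℝ, (V t).map f = (U t).map f := fun f =>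
    (hU.map f).unique hτ hstab (hV.map f) ht
  ext i j
  exact Complex.ext (congrFun₂ (h Complex.reCLM) i j) (congrFun₂ (h Complex.imCLM) i j)

end Reflection

end DelayLyapunov

theorem mainTheorem1 {n : ℕ} (A₀ A₁ W : Matrix (Fin n) (Fin n) ℝ) (τ : ℝ) (hτ : 0 ≤ τ)
    (hstab : DelayLyapunov.ExponentiallyStable A₀ A₁ τ) (hW : W.IsSymm) :
    ∃ U : ℝ → Matrix (Fin n) (Fin n) ℂ,
      DelayLyapunov.IsDelayLyapunovSolution A₀ A₁ W τ U ∧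
      (∀ V : ℝ → Matrix (Fin n) (Fin n) ℂ,
        DelayLyapunov.IsDelayLyapunovSolution A₀ A₁ W τ V → Set.EqOn V U (Set.Icc (-τ) τ)) ∧
      ∀ c : ℝ, c ≠ 0 → ∃ X : Matrix (Fin n) (Fin n) ℝ,
        U (τ / 2) = DelayLyapunov.toComplex X ∧
        DelayLyapunov.Lop A₀ A₁ τ c X = -W ∧
        ∀ Y : Matrix (Fin n) (Fin n) ℝ, DelayLyapunov.Lop A₀ A₁ τ c Y = -W → Y = X := by
  -- any nonzero parameter produces the solution; the value `1` is arbitrary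
  obtain ⟨X, hX⟩ := LinearMap.injective_iff_surjective.1
    (DelayLyapunov.Lop_injective hτ hstab one_ne_zero) (-W)
  obtain ⟨G, rfl, hG⟩ := DelayLyapunov.exists_isReflectionSolution A₀ A₁ X
  have hU := hG.isRealLyapunovSolution hτ one_ne_zero hW hX
  refine ⟨_, hU.toComplex, fun V hV => hU.toComplex.unique hτ hstab hV,
    fun c hc => ⟨_, rfl, hU.Lop_eq hτ c, fun Y hY => ?_⟩⟩
  exact DelayLyapunov.Lop_injective hτ hstab hc (hY.trans (hU.Lop_eq hτ c).symm)
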